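/- For a rational map $F:\hat{\mathbb C}\to\hat{\mathbb C}$ of the Riemann sphere let $\mathrm{Deck}(F)$ be the group, under composition, of all Möbius transformations $\mu$ with $F\circ\mu=F$; let $F^k$ denote the $k$-th iterate of $F$, and let $D_n$ denote the dihedral group of order $n$ (with $D_4$ the Klein four-group). Let $d\ge 2$ be an even integer. 1. If $f(z)=\dfrac{z^d-a}{z^d+a}$ for some $a\in\mathbb C$, $a\neq 0$, then $\mathrm{Deck}(f^2)\cong D_{2d}$. 2. If $g(z)=\dfrac{z^d-1}{z^d+1}$, then $\mathrm{Deck}(g^3)\cong D_{4d}$. -/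

import Mathlib

open scoped OnePoint

noncomputable section

/-- The self-map of the Riemann sphere `ℂ ∪ {∞}` induced by a rational function `r = p / q` in lowest
terms: a finite point `z` goes to `p(z) / q(z)` (to `∞` if `q(z) = 0`), and `∞` goes to the limit
of `p(z) / q(z)` as `z → ∞`. -/
def RatFunc.sphereMap (r : RatFunc ℂ) : OnePoint ℂ → OnePoint ℂ
  | some z => if r.denom.eval z = 0 then ∞ else ((r.num.eval z / r.denom.eval z : ℂ) : OnePoint ℂ)
  | ∞ =>
    if r.denom.natDegree < r.num.natDegree then ∞
    else ((r.num.coeff r.denom.natDegree / r.denom.leadingCoeff : ℂ) : OnePoint ℂ)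

/-- The group of Möbius transformations `z ↦ (α z + β) / (γ z + δ)`, `α δ - β γ ≠ 0`, of the Riemann
sphere, as bijections of the sphere under composition: the image of `GL₂(ℂ)` acting on
`ℂ ∪ {∞}`. -/
def Moebius : Subgroup (Equiv.Perm (OnePoint ℂ)) :=
  (MulAction.toPermHom (GL (Fin 2) ℂ) (OnePoint ℂ)).range

/-- The deck group of a self-map `f` of the Riemann sphere: the Möbius transformations `μ` with
`f ∘ μ = f`. -/
def Deck (f : OnePoint ℂ → OnePoint ℂ) : Subgroup Moebius where
  carrier := {μ | f ∘ (μ : Equiv.Perm (OnePoint ℂ)) = f}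
  one_mem' := rfl
  mul_mem' := by
    intro μ ν hμ hν
    funext z
    exact (congrFun hμ _).trans (congrFun hν z)
  inv_mem' := by
    intro μ hμ
    funext z
    have h := congrFun hμ ((μ : Equiv.Perm (OnePoint ℂ))⁻¹ z)
    simpa using h.symm

end

open scoped OnePoint

open Filter Topology

/-! Each map is a Cayley transform after a `d`-th power. The outer Cayley transform cancels, so `μ`
is a deck transformation of an iterate exactly when it preserves `T ^ d`, with `T` the preceding
iterate (`mem_Deck_cayleyPow_comp`). Now `0` is critical for `T`, and no point of `ℂ \ {0}` in the
same `T ^ d`-fibre is; comparing derivatives gives `μ 0 ∈ {0, ∞}`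
(`apply_zero_mem_of_spherePow_comp_eq`). Since the group contains some `z ↦ e / z`, all of it
preserves `{0, ∞}`, hence consists of scalings and inversions, and it is dihedral once its scalings
are known (`nonempty_mulEquiv_dihedralGroup`). For the second iterate the zeros of `T` force `u ^ d
= 1`; for the third, its poles force `u ^ d = ±1`. Both values occur because Cayley transforms turn
`-z` into `1 / z` and `1 / z` back into a sign, which the even power kills. -/

noncomputable section

/-! ### Scalings and inversions. -/

namespace Moebius

/-- The Möbius transformation of a matrix. -/
def ofMatrix (g : GL (Fin 2) ℂ) : Moebius :=
  ⟨MulAction.toPermHom (GL (Fin 2) ℂ) (OnePoint ℂ) g, g, rfl⟩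

theorem ofMatrix_apply (g : GL (Fin 2) ℂ) (x : OnePoint ℂ) :
    (ofMatrix g : Equiv.Perm (OnePoint ℂ)) x = g • x := rfl

theorem exists_ofMatrix (μ : Moebius) : ∃ g, μ = ofMatrix g := by
  obtain ⟨_, g, rfl⟩ := μ
  exact ⟨g, rfl⟩

theorem ext_apply {μ ν : Moebius}
    (h : ∀ x, (μ : Equiv.Perm (OnePoint ℂ)) x = (ν : Equiv.Perm (OnePoint ℂ)) x) : μ = ν :=
  Subtype.ext (Equiv.ext h)

theorem mul_apply (μ ν : Moebius) (x : OnePoint ℂ) :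
    ((μ * ν : Moebius) : Equiv.Perm (OnePoint ℂ)) x =
      (μ : Equiv.Perm (OnePoint ℂ)) ((ν : Equiv.Perm (OnePoint ℂ)) x) := rfl

/-- The transformation `z ↦ u z`. -/
def scaling (u : ℂˣ) : Moebius :=
  ofMatrix (Matrix.GeneralLinearGroup.mkOfDetNeZero !![(u : ℂ), 0; 0, 1] (by simp))

/-- The transformation `z ↦ u / z`. -/
def inversion (u : ℂˣ) : Moebius :=
  ofMatrix (Matrix.GeneralLinearGroup.mkOfDetNeZero !![0, (u : ℂ); 1, 0] (by simp))

@[simp] theorem scaling_infty (u : ℂˣ) : (scaling u : Equiv.Perm (OnePoint ℂ)) ∞ = ∞ := by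
  simp [scaling, ofMatrix_apply, OnePoint.smul_infty_eq_ite,
    Matrix.GeneralLinearGroup.mkOfDetNeZero]

@[simp] theorem scaling_coe (u : ℂˣ) (z : ℂ) :
    (scaling u : Equiv.Perm (OnePoint ℂ)) (z : OnePoint ℂ) = ((u * z : ℂ) : OnePoint ℂ) := by
  simp [scaling, ofMatrix_apply, OnePoint.smul_some_eq_ite,
    Matrix.GeneralLinearGroup.mkOfDetNeZero]

@[simp] theorem inversion_infty (u : ℂˣ) :
    (inversion u : Equiv.Perm (OnePoint ℂ)) ∞ = ((0 : ℂ) : OnePoint ℂ) := by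
  simp [inversion, ofMatrix_apply, OnePoint.smul_infty_eq_ite,
    Matrix.GeneralLinearGroup.mkOfDetNeZero]

theorem inversion_coe (u : ℂˣ) (z : ℂ) :
    (inversion u : Equiv.Perm (OnePoint ℂ)) (z : OnePoint ℂ) =
      if z = 0 then ∞ else ((u / z : ℂ) : OnePoint ℂ) := by
  simp [inversion, ofMatrix_apply, OnePoint.smul_some_eq_ite,
    Matrix.GeneralLinearGroup.mkOfDetNeZero]

@[simp] theorem inversion_zero (u : ℂˣ) :
    (inversion u : Equiv.Perm (OnePoint ℂ)) ((0 : ℂ) : OnePoint ℂ) = ∞ := by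
  simp [inversion_coe]

theorem scaling_one : scaling 1 = 1 := by
  refine ext_apply fun x => ?_
  cases x using OnePoint.rec <;> simp

theorem scaling_mul_scaling (u v : ℂˣ) : scaling u * scaling v = scaling (u * v) := by
  refine ext_apply fun x => ?_
  cases x using OnePoint.rec <;> simp [mul_assoc]

theorem scaling_mul_inversion (u v : ℂˣ) : scaling u * inversion v = inversion (u * v) := by
  refine ext_apply fun x => ?_
  cases x using OnePoint.rec with
  | infty => simp
  | coe z =>
    by_cases hz : z = 0 <;> simp [inversion_coe, hz, mul_div_assoc]

theorem inversion_mul_scaling (u v : ℂˣ) : inversion u * scaling v = inversion (u / v) := by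
  refine ext_apply fun x => ?_
  cases x using OnePoint.rec with
  | infty => simp
  | coe z =>
    by_cases hz : z = 0 <;> simp [inversion_coe, hz, div_div]

theorem inversion_mul_inversion (u v : ℂˣ) : inversion u * inversion v = scaling (u / v) := by
  refine ext_apply fun x => ?_
  cases x using OnePoint.rec with
  | infty => simp
  | coe z =>
    by_cases hz : z = 0
    · simp [hz]
    · simp [inversion_coe, hz, div_div_eq_mul_div, div_mul_eq_mul_div]

theorem scaling_injective : Function.Injective scaling := by
  intro u v h
  have h1 := congrArg (fun μ : Moebius => (μ : Equiv.Perm (OnePoint ℂ)) ((1 : ℂ) : OnePoint ℂ)) h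
  simpa [Units.ext_iff] using h1

theorem scaling_ne_inversion (u v : ℂˣ) : scaling u ≠ inversion v := by
  intro h
  have h1 := congrArg (fun μ : Moebius => (μ : Equiv.Perm (OnePoint ℂ)) ∞) h
  simp at h1

theorem inversion_injective : Function.Injective inversion := by
  intro u v h
  have h1 : scaling u * inversion 1 = scaling v * inversion 1 := by
    simpa [scaling_mul_inversion] using h
  exact scaling_injective (mul_right_cancel h1)

/-- A Möbius transformation preserving `{0, ∞}` is `z ↦ u z` or `z ↦ u / z`. -/
theorem eq_scaling_or_inversion (μ : Moebius)
    (h0 : (μ : Equiv.Perm (OnePoint ℂ)) ((0 : ℂ) : OnePoint ℂ) ∈ ({((0 : ℂ) : OnePoint ℂ), ∞} : Set _))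
    (h1 : (μ : Equiv.Perm (OnePoint ℂ)) ∞ ∈ ({((0 : ℂ) : OnePoint ℂ), ∞} : Set _)) :
    (∃ u, μ = scaling u) ∨ ∃ u, μ = inversion u := by
  obtain ⟨g, rfl⟩ := exists_ofMatrix μ
  have hdet : g 0 0 * g 1 1 - g 0 1 * g 1 0 ≠ 0 := by
    have := g.det_ne_zero
    rwa [Matrix.det_fin_two] at this
  rw [ofMatrix_apply, OnePoint.smul_some_eq_ite] at h0
  rw [ofMatrix_apply, OnePoint.smul_infty_eq_ite] at h1
  simp only [mul_zero, zero_add] at h0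
  by_cases hs : g 1 1 = 0
  · right
    have hq : g 0 1 ≠ 0 := by rintro h; simp [hs, h] at hdet
    have hr : g 1 0 ≠ 0 := by rintro h; simp [hs, h] at hdet
    have hp : g 0 0 = 0 := by simpa [hr] using h1
    refine ⟨Units.mk0 (g 0 1 / g 1 0) (div_ne_zero hq hr), ext_apply fun x => ?_⟩
    cases x using OnePoint.rec with
    | infty => simp [ofMatrix_apply, OnePoint.smul_infty_eq_ite, hr, hp]
    | coe z =>
      by_cases hz : z = 0 <;>
        simp [ofMatrix_apply, OnePoint.smul_some_eq_ite, hr, hp, hs, inversion_coe, hz, div_div]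
  · left
    have hq : g 0 1 = 0 := by simpa [hs] using h0
    have hp : g 0 0 ≠ 0 := by rintro h; simp [hq, h] at hdet
    have hr : g 1 0 = 0 := by
      by_contra hr
      simp [hr, hp] at h1
    refine ⟨Units.mk0 (g 0 0 / g 1 1) (div_ne_zero hp hs), ext_apply fun x => ?_⟩
    cases x using OnePoint.rec with
    | infty => simp [ofMatrix_apply, OnePoint.smul_infty_eq_ite, hr]
    | coe z =>
      simp [ofMatrix_apply, OnePoint.smul_some_eq_ite, hr, hq, hs, mul_div_right_comm]

end Moebius

open Moebius

/-! ### Dihedral groups of Möbius transformations. -/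

/-- The cyclic group `ℤ/n` as the group of `n`-th roots of unity. -/
def zmodEquivRootsOfUnity (n : ℕ) [NeZero n] : Multiplicative (ZMod n) ≃* rootsOfUnity n ℂ :=
  mulEquivOfCyclicCardEq ((Nat.card_zmod n).trans (Complex.card_rootsOfUnity n).symm)

/-- The dihedral group generated by the scalings by `n`-th roots of unity and `z ↦ e / z`. -/
def dihedralHom (n : ℕ) [NeZero n] (e : ℂˣ) : DihedralGroup n →* Moebius :=
  let χ : ZMod n → ℂˣ := fun i => zmodEquivRootsOfUnity n (Multiplicative.ofAdd i)
  have hadd : ∀ i j, χ (i + j) = χ i * χ j := fun i j => by simp [χ]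
  have hsub : ∀ i j, χ (i - j) = χ i / χ j := fun i j => by
    rw [eq_div_iff_mul_eq', ← hadd, sub_add_cancel]
  MonoidHom.mk'
    (fun x => match x with
      | .r i => scaling (χ i)
      -- Dividing by `χ i` matches the convention `r i * sr j = sr (j - i)`.
      | .sr i => inversion (e / χ i))
    (by
      rintro (i | i) (j | j)
      · simp [DihedralGroup.r_mul_r, scaling_mul_scaling, hadd]
      · simp only [DihedralGroup.r_mul_sr, scaling_mul_inversion, hsub]
        congr 1
        rw [div_div_eq_mul_div, mul_div_assoc', mul_comm]
      · simp only [DihedralGroup.sr_mul_r, inversion_mul_scaling, hadd, div_div]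
      · simp only [DihedralGroup.sr_mul_sr, inversion_mul_inversion, hsub]
        congr 1
        rw [div_div_div_cancel_left])

/-- A condition at `0` suffices: `μ ∞` is the image of `0` under `μ * inversion e`, again in `D`.
Inversions in `D` differ from `inversion e` by a scaling in `D`. -/
theorem nonempty_mulEquiv_dihedralGroup {n : ℕ} (hn : n ≠ 0) (D : Subgroup Moebius) (e : ℂˣ)
    (he : inversion e ∈ D) (hscaling : ∀ u, scaling u ∈ D ↔ u ^ n = 1)
    (hzero : ∀ μ ∈ D, (μ : Equiv.Perm (OnePoint ℂ)) ((0 : ℂ) : OnePoint ℂ) ∈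
      ({((0 : ℂ) : OnePoint ℂ), ∞} : Set _)) :
    Nonempty (D ≃* DihedralGroup n) := by
  have : NeZero n := ⟨hn⟩
  have hinj : Function.Injective (dihedralHom n e) := by
    rintro (i | i) (j | j) h
    · have := scaling_injective h
      simpa using this
    · exact absurd h (scaling_ne_inversion _ _)
    · exact absurd h.symm (scaling_ne_inversion _ _)
    · have := inversion_injective h
      simpa using this
  have hroot : ∀ u : ℂˣ, u ^ n = 1 →
      ∃ i : ZMod n, u = zmodEquivRootsOfUnity n (Multiplicative.ofAdd i) := fun u hu =>
    ⟨Multiplicative.toAdd ((zmodEquivRootsOfUnity n).symm ⟨u, hu⟩), by simp⟩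
  have hrange : (dihedralHom n e).range = D := by
    ext μ
    constructor
    · rintro ⟨i | i, rfl⟩
      · exact (hscaling _).2 (zmodEquivRootsOfUnity n (Multiplicative.ofAdd i)).2
      · change inversion (e / _) ∈ D
        rw [← inversion_mul_scaling]
        exact D.mul_mem he ((hscaling _).2 (zmodEquivRootsOfUnity n (Multiplicative.ofAdd i)).2)
    · intro hμ
      have hinf := hzero _ (D.mul_mem hμ he)
      rw [mul_apply, inversion_zero] at hinf
      rcases eq_scaling_or_inversion μ (hzero μ hμ) hinf with ⟨u, rfl⟩ | ⟨u, rfl⟩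
      · obtain ⟨i, rfl⟩ := hroot u ((hscaling u).1 hμ)
        exact ⟨.r i, rfl⟩
      · have h := D.mul_mem he hμ
        rw [inversion_mul_inversion] at h
        obtain ⟨i, hi⟩ := hroot _ ((hscaling _).1 h)
        refine ⟨.sr i, ?_⟩
        exact (congrArg (fun v => inversion (e / v)) hi.symm).trans
          (congrArg inversion (div_div_cancel e u))
  exact ⟨((MonoidHom.ofInjective hinj).trans (MulEquiv.subgroupCongr hrange)).symm⟩

/-! ### Power maps, Cayley transforms and the given rational functions. -/

theorem RatFunc.num_denom_div_of_isCoprime {K : Type*} [Field K] {p q : Polynomial K}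
    (hq : q.Monic) (h : IsCoprime p q) :
    (algebraMap _ (RatFunc K) p / algebraMap _ (RatFunc K) q).num = p ∧
      (algebraMap _ (RatFunc K) p / algebraMap _ (RatFunc K) q).denom = q := by
  classical
  have hg : gcd p q = 1 := by
    rw [← normalize_gcd p q]
    exact normalize_eq_one.2 ((gcd_isUnit_iff p q).2 h)
  have h1 : ∀ r : Polynomial K, r / 1 = r := fun r => by
    simp
  constructor
  · rw [RatFunc.num_div, hg, h1, h1, hq.leadingCoeff]
    simp
  · rw [RatFunc.denom_div p hq.ne_zero, hg, h1, hq.leadingCoeff]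
    simp

/-- The `d`-th power map of the Riemann sphere. -/
def spherePow (d : ℕ) : OnePoint ℂ → OnePoint ℂ := OnePoint.map (· ^ d)

@[simp] theorem spherePow_infty (d : ℕ) : spherePow d ∞ = ∞ := rfl

@[simp] theorem spherePow_coe (d : ℕ) (z : ℂ) :
    spherePow d (z : OnePoint ℂ) = ((z ^ d : ℂ) : OnePoint ℂ) := rfl

theorem spherePow_scaling (d : ℕ) (u : ℂˣ) (x : OnePoint ℂ) :
    spherePow d ((scaling u : Equiv.Perm (OnePoint ℂ)) x) =
      (scaling (u ^ d) : Equiv.Perm (OnePoint ℂ)) (spherePow d x) := by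
  cases x using OnePoint.rec <;> simp [mul_pow]

theorem spherePow_inversion {d : ℕ} (hd : d ≠ 0) (u : ℂˣ) (x : OnePoint ℂ) :
    spherePow d ((inversion u : Equiv.Perm (OnePoint ℂ)) x) =
      (inversion (u ^ d) : Equiv.Perm (OnePoint ℂ)) (spherePow d x) := by
  cases x using OnePoint.rec with
  | infty => simp [hd]
  | coe z => by_cases hz : z = 0 <;> simp [inversion_coe, hz, hd, div_pow]

theorem spherePow_scaling_neg_one {d : ℕ} (hd : Even d) (x : OnePoint ℂ) :
    spherePow d ((scaling (-1) : Equiv.Perm (OnePoint ℂ)) x) = spherePow d x := by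
  rw [spherePow_scaling, hd.neg_one_pow, scaling_one]
  rfl

namespace Moebius

/-- The transformation `z ↦ (z - a) / (z + a)`. -/
def cayley (a : ℂˣ) : Moebius :=
  ofMatrix (Matrix.GeneralLinearGroup.mkOfDetNeZero !![1, -(a : ℂ); 1, a] (by
    simp [Matrix.det_fin_two]))

@[simp] theorem cayley_infty (a : ℂˣ) :
    (cayley a : Equiv.Perm (OnePoint ℂ)) ∞ = ((1 : ℂ) : OnePoint ℂ) := by
  simp [cayley, ofMatrix_apply, OnePoint.smul_infty_eq_ite,
    Matrix.GeneralLinearGroup.mkOfDetNeZero]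

theorem cayley_coe (a : ℂˣ) (z : ℂ) :
    (cayley a : Equiv.Perm (OnePoint ℂ)) (z : OnePoint ℂ) =
      if z + a = 0 then ∞ else (((z - a) / (z + a) : ℂ) : OnePoint ℂ) := by
  simp [cayley, ofMatrix_apply, OnePoint.smul_some_eq_ite,
    Matrix.GeneralLinearGroup.mkOfDetNeZero, sub_eq_add_neg]

/-- The involution `a ^ 2 / z` fixes `±a`, which `cayley a` sends to `0` and `∞`; so it becomes the
involution fixing those two points. -/
theorem cayley_mul_inversion (a : ℂˣ) :
    cayley a * inversion (a ^ 2) = scaling (-1) * cayley a := by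
  refine ext_apply fun x => ?_
  cases x using OnePoint.rec with
  | infty => simp [cayley_coe]
  | coe z =>
    have ha := a.ne_zero
    by_cases hz : z = 0
    · simp [hz, cayley_coe]
    · by_cases hza : z + a = 0
      · have : z = -a := by linear_combination hza
        subst this
        simp [cayley_coe, inversion_coe, div_neg, pow_two]
      · have h : (a : ℂ) ^ 2 / z + a ≠ 0 := by
          have : (a : ℂ) ^ 2 / z + a = a * (z + a) / z := by field_simp; ring
          rw [this]
          exact div_ne_zero (mul_ne_zero ha hza) hz
        simp [cayley_coe, inversion_coe, hz, hza, h]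
        rw [← neg_div, div_eq_div_iff h hza]
        field_simp
        ring

/-- Negation swaps `±1` and fixes `0` and `∞`; after the Cayley transform it swaps `0` and `∞` and
fixes `±1`. -/
theorem cayley_one_mul_scaling : cayley 1 * scaling (-1) = inversion 1 * cayley 1 := by
  refine ext_apply fun x => ?_
  cases x using OnePoint.rec with
  | infty => simp [inversion_coe]
  | coe z =>
    by_cases h1 : z = 1
    · simp [h1, cayley_coe]
    · by_cases h2 : z + 1 = 0
      · have : z = -1 := by linear_combination h2
        subst this
        simp [cayley_coe]
      · have h3 : -z + 1 ≠ 0 := fun h => h1 (by linear_combination -h)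
        have h4 : z - 1 ≠ 0 := fun h => h1 (by linear_combination h)
        simp [cayley_coe, inversion_coe, h2, h3, h4]
        field_simp
        ring

end Moebius

/-- The map `z ↦ (z ^ d - a) / (z ^ d + a)` of the Riemann sphere. -/
def cayleyPow (d : ℕ) (a : ℂˣ) (x : OnePoint ℂ) : OnePoint ℂ :=
  (cayley a : Equiv.Perm (OnePoint ℂ)) (spherePow d x)

theorem sphereMap_eq_cayleyPow {d : ℕ} (hd : d ≠ 0) (a : ℂˣ) :
    RatFunc.sphereMap ((RatFunc.X ^ d - RatFunc.C (a : ℂ)) / (RatFunc.X ^ d + RatFunc.C (a : ℂ))) =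
      cayleyPow d a := by
  have hq : (Polynomial.X ^ d + Polynomial.C (a : ℂ)).Monic := Polynomial.monic_X_pow_add_C _ hd
  have hco : IsCoprime (Polynomial.X ^ d - Polynomial.C (a : ℂ))
      (Polynomial.X ^ d + Polynomial.C (a : ℂ)) := by
    -- Denominator minus numerator is the constant `2 * a`.
    refine ⟨-Polynomial.C (2 * (a : ℂ))⁻¹, Polynomial.C (2 * (a : ℂ))⁻¹, ?_⟩
    have h : Polynomial.C (2 * (a : ℂ))⁻¹ * Polynomial.C (2 * (a : ℂ)) = 1 := by
      rw [← Polynomial.C_mul, inv_mul_cancel₀ (by simp), Polynomial.C_1]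
    have h2 : Polynomial.C (2 * (a : ℂ)) = Polynomial.C (a : ℂ) + Polynomial.C (a : ℂ) := by
      rw [← Polynomial.C_add, two_mul]
    rw [h2] at h
    linear_combination h
  obtain ⟨hnum, hden⟩ := RatFunc.num_denom_div_of_isCoprime hq hco
  have hrat : (RatFunc.X ^ d - RatFunc.C (a : ℂ)) / (RatFunc.X ^ d + RatFunc.C (a : ℂ)) =
      algebraMap _ (RatFunc ℂ) (Polynomial.X ^ d - Polynomial.C (a : ℂ)) /
        algebraMap _ (RatFunc ℂ) (Polynomial.X ^ d + Polynomial.C (a : ℂ)) := by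
    simp
  rw [← hrat] at hnum hden
  funext x
  cases x using OnePoint.rec with
  | infty =>
    have h1 : (Polynomial.X ^ d + Polynomial.C (a : ℂ)).natDegree = d :=
      Polynomial.natDegree_X_pow_add_C
    have h2 : (Polynomial.X ^ d - Polynomial.C (a : ℂ)).natDegree = d :=
      Polynomial.natDegree_X_pow_sub_C
    change (if _ then _ else _) = _
    rw [hnum, hden, h1, h2, hq.leadingCoeff]
    simp [cayleyPow, Polynomial.coeff_C, hd]
  | coe z =>
    change (if _ then _ else _) = _
    rw [hnum, hden]
    simp [cayleyPow, cayley_coe]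

/-! ### Zeros, poles and derivatives. -/

theorem cayleyPow_coe {d : ℕ} {a : ℂˣ} {z : ℂ} (h : z ^ d + a ≠ 0) :
    cayleyPow d a (z : OnePoint ℂ) = (((z ^ d - a) / (z ^ d + a) : ℂ) : OnePoint ℂ) := by
  simp [cayleyPow, cayley_coe, h]

theorem cayleyPow_zero {d : ℕ} (hd : d ≠ 0) (a : ℂˣ) :
    cayleyPow d a ((0 : ℂ) : OnePoint ℂ) = ((-1 : ℂ) : OnePoint ℂ) := by
  rw [cayleyPow_coe (by simp [hd])]
  simp [hd]

theorem cayleyPow_eq_zero_iff {d : ℕ} {a : ℂˣ} {x : OnePoint ℂ} :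
    cayleyPow d a x = ((0 : ℂ) : OnePoint ℂ) ↔ ∃ z : ℂ, x = z ∧ z ^ d = a := by
  cases x using OnePoint.rec with
  | infty => simp [cayleyPow]
  | coe z =>
    by_cases h : z ^ d + a = 0
    · have h' : z ^ d ≠ a := fun h' => a.ne_zero (by linear_combination (h - h') / 2)
      simp [cayleyPow, cayley_coe, h, h']
    · simp [cayleyPow, cayley_coe, h, sub_eq_zero]

theorem cayleyPow_eq_infty_iff {d : ℕ} {a : ℂˣ} {x : OnePoint ℂ} :
    cayleyPow d a x = ∞ ↔ ∃ z : ℂ, x = z ∧ z ^ d + a = 0 := by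
  cases x using OnePoint.rec with
  | infty => simp [cayleyPow]
  | coe z => simp [cayleyPow, cayley_coe]

theorem spherePow_eq_coe_iff {d : ℕ} {x : OnePoint ℂ} {w : ℂ} :
    spherePow d x = (w : OnePoint ℂ) ↔ ∃ z : ℂ, x = z ∧ z ^ d = w := by
  cases x using OnePoint.rec <;> simp

theorem eventually_cayleyPow_coe {d : ℕ} {a : ℂˣ} {z : ℂ} (h : z ^ d + a ≠ 0) :
    ∀ᶠ w : ℂ in 𝓝 z, cayleyPow d a (w : OnePoint ℂ) =
      (((w ^ d - a) / (w ^ d + a) : ℂ) : OnePoint ℂ) := by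
  have hc : ContinuousAt (fun w : ℂ => w ^ d + a) z := by fun_prop
  filter_upwards [hc.eventually_ne h] with w hw using cayleyPow_coe hw

theorem hasDerivAt_cayleyPow {d : ℕ} {a : ℂˣ} {z : ℂ} (h : z ^ d + a ≠ 0) :
    HasDerivAt (fun w : ℂ => (w ^ d - a) / (w ^ d + a))
      (2 * (a : ℂ) * (d * z ^ (d - 1)) / (z ^ d + a) ^ 2) z := by
  have h1 := hasDerivAt_pow d z
  refine ((h1.sub_const (a : ℂ)).div (h1.add_const (a : ℂ)) h).congr_deriv ?_
  ring

theorem deriv_cayleyPow_ne_zero {d : ℕ} (hd : d ≠ 0) {a : ℂˣ} {z : ℂ} (h : z ^ d + a ≠ 0)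
    (hz : z ≠ 0) : 2 * (a : ℂ) * (d * z ^ (d - 1)) / (z ^ d + a) ^ 2 ≠ 0 := by
  simp [h, hz, hd]

/-- If `T` has a critical point at `0` and no critical point on the rest of the `T ^ d`-fibre
of `0`, then a Möbius transformation preserving `T ^ d` does not move `0` to a point of `ℂ \ {0}`. -/
theorem apply_zero_mem_of_spherePow_comp_eq {d : ℕ} (hd : d ≠ 0) {T : OnePoint ℂ → OnePoint ℂ}
    {k : ℂ → ℂ} (hk0 : HasDerivAt k 0 0)
    (hT0 : ∀ᶠ z : ℂ in 𝓝 0, T (z : OnePoint ℂ) = (k z : OnePoint ℂ))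
    (hfib : ∀ w : ℂ, w ≠ 0 →
      spherePow d (T (w : OnePoint ℂ)) = spherePow d (T ((0 : ℂ) : OnePoint ℂ)) →
      (∃ k' ≠ 0, HasDerivAt k k' w) ∧ ∀ᶠ z : ℂ in 𝓝 w, T (z : OnePoint ℂ) = (k z : OnePoint ℂ))
    (μ : Moebius)
    (hμ : ∀ x, spherePow d (T ((μ : Equiv.Perm (OnePoint ℂ)) x)) = spherePow d (T x)) :
    (μ : Equiv.Perm (OnePoint ℂ)) ((0 : ℂ) : OnePoint ℂ) ∈
      ({((0 : ℂ) : OnePoint ℂ), ∞} : Set _) := by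
  obtain ⟨g, rfl⟩ := exists_ofMatrix μ
  by_contra hmem
  rw [Set.mem_insert_iff, Set.mem_singleton_iff, not_or] at hmem
  obtain ⟨hne0, hneinf⟩ := hmem
  have hs : g 1 1 ≠ 0 := by
    intro h
    apply hneinf
    simp [ofMatrix_apply, OnePoint.smul_some_eq_ite, h]
  set m : ℂ → ℂ := fun z => (g 0 0 * z + g 0 1) / (g 1 0 * z + g 1 1) with hm
  have hdet : g 0 0 * g 1 1 - g 0 1 * g 1 0 ≠ 0 := by
    have := g.det_ne_zero
    rwa [Matrix.det_fin_two] at this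
  obtain ⟨m', hm'0, hm'⟩ : ∃ m' ≠ 0, HasDerivAt m m' 0 := by
    refine ⟨(g 0 0 * g 1 1 - g 0 1 * g 1 0) / (g 1 1) ^ 2, by simp [hdet, hs], ?_⟩
    have h1 : HasDerivAt (fun z : ℂ => g 0 0 * z + g 0 1) (g 0 0) 0 := by
      simpa using ((hasDerivAt_id (0 : ℂ)).const_mul (g 0 0)).add_const (g 0 1)
    have h2 : HasDerivAt (fun z : ℂ => g 1 0 * z + g 1 1) (g 1 0) 0 := by
      simpa using ((hasDerivAt_id (0 : ℂ)).const_mul (g 1 0)).add_const (g 1 1)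
    refine (h1.div h2 (by simpa using hs)).congr_deriv ?_
    simp
  have hgm : ∀ᶠ z : ℂ in 𝓝 0, g • (z : OnePoint ℂ) = (m z : OnePoint ℂ) := by
    have hc : ContinuousAt (fun z : ℂ => g 1 0 * z + g 1 1) 0 := by fun_prop
    filter_upwards [hc.eventually_ne (by simpa using hs)] with z hz
    simp [OnePoint.smul_some_eq_ite, hz, hm]
  have hw : (ofMatrix g : Equiv.Perm (OnePoint ℂ)) ((0 : ℂ) : OnePoint ℂ) = (m 0 : OnePoint ℂ) :=
    hgm.self_of_nhds
  have hw0 : m 0 ≠ 0 := fun h => hne0 (by rw [hw, h])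
  obtain ⟨⟨k', hk'0, hk'⟩, hTw⟩ := hfib (m 0) hw0 (by rw [← hw]; exact hμ _)
  have hcomp : HasDerivAt (fun z => k (m z)) (k' * m') 0 := hk'.comp 0 hm'
  have hpow : ∀ᶠ z : ℂ in 𝓝 0, k (m z) ^ d = k z ^ d := by
    filter_upwards [hgm, hT0, hm'.continuousAt.eventually hTw] with z h1 h2 h3
    have h := hμ (z : OnePoint ℂ)
    rw [ofMatrix_apply, h1, h2, h3] at h
    simpa using h
  have hpow0 : k (m 0) ^ d = k 0 ^ d := hpow.self_of_nhds
  -- Differentiating `k (m z) ^ d = k z ^ d` says nothing where `k` vanishes; there, equal norms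
  -- make `k ∘ m` be `o(z)` as `k` is, so its derivative is still zero.
  by_cases hk : k 0 = 0
  · have hkm : k (m 0) = 0 := by simpa [hk, hd] using hpow0
    have hnorm : ∀ᶠ z : ℂ in 𝓝 0, ‖k (m z)‖ = ‖k z‖ := by
      filter_upwards [hpow] with z hz
      have := congrArg norm hz
      rw [norm_pow, norm_pow] at this
      exact (pow_left_inj₀ (norm_nonneg _) (norm_nonneg _) hd).1 this
    have ho : HasDerivAt (fun z => k (m z)) 0 0 := by
      rw [hasDerivAt_iff_isLittleO] at hk0 ⊢
      simp only [hk, hkm, sub_zero, smul_zero] at hk0 ⊢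
      exact (Asymptotics.IsBigO.of_bound' (hnorm.mono fun z hz => hz.le)).trans_isLittleO hk0
    exact mul_ne_zero hk'0 hm'0 (hcomp.unique ho)
  · have hkm : k (m 0) ≠ 0 := by
      intro h
      rw [h, zero_pow hd] at hpow0
      exact hk (pow_eq_zero_iff hd |>.1 hpow0.symm)
    have h1 := (hcomp.pow d).congr_of_eventuallyEq (hpow.mono fun z hz => hz.symm)
    have h2 := h1.unique (hk0.pow d)
    simp [hd, hkm, hk'0, hm'0] at h2

/-! ### The second iterate. -/

theorem mem_Deck {F : OnePoint ℂ → OnePoint ℂ} {μ : Moebius} :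
    μ ∈ Deck F ↔ ∀ x, F ((μ : Equiv.Perm (OnePoint ℂ)) x) = F x :=
  funext_iff

theorem mem_Deck_cayleyPow_comp {d : ℕ} {a : ℂˣ} {T : OnePoint ℂ → OnePoint ℂ} {μ : Moebius} :
    μ ∈ Deck (fun x => cayleyPow d a (T x)) ↔
      ∀ x, spherePow d (T ((μ : Equiv.Perm (OnePoint ℂ)) x)) = spherePow d (T x) := by
  simp only [mem_Deck, cayleyPow, EmbeddingLike.apply_eq_iff_eq]

theorem exists_unit_pow_eq {d : ℕ} (hd : d ≠ 0) (u : ℂˣ) : ∃ e : ℂˣ, e ^ d = u := by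
  obtain ⟨e, he⟩ := IsAlgClosed.exists_pow_nat_eq (u : ℂ) (Nat.pos_of_ne_zero hd)
  have he0 : e ≠ 0 := by
    rintro rfl
    exact u.ne_zero (by rw [← he, zero_pow hd])
  exact ⟨Units.mk0 e he0, Units.ext (by simpa using he)⟩

theorem cayleyPow_inversion {d : ℕ} (hd : d ≠ 0) {a e : ℂˣ} (he : e ^ d = a ^ 2)
    (x : OnePoint ℂ) :
    cayleyPow d a ((inversion e : Equiv.Perm (OnePoint ℂ)) x) =
      (scaling (-1) : Equiv.Perm (OnePoint ℂ)) (cayleyPow d a x) := by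
  rw [cayleyPow, spherePow_inversion hd, he, ← mul_apply, cayley_mul_inversion]
  rfl

theorem cayleyPow_scaling_of_pow_eq_one {d : ℕ} {a u : ℂˣ} (hu : u ^ d = 1) (x : OnePoint ℂ) :
    cayleyPow d a ((scaling u : Equiv.Perm (OnePoint ℂ)) x) = cayleyPow d a x := by
  rw [cayleyPow, spherePow_scaling, hu, scaling_one]
  rfl

theorem cayleyPow_scaling_of_pow_eq_neg_one {d : ℕ} {u : ℂˣ} (hu : u ^ d = -1)
    (x : OnePoint ℂ) :
    cayleyPow d 1 ((scaling u : Equiv.Perm (OnePoint ℂ)) x) =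
      (inversion 1 : Equiv.Perm (OnePoint ℂ)) (cayleyPow d 1 x) := by
  rw [cayleyPow, spherePow_scaling, hu, ← mul_apply, cayley_one_mul_scaling]
  rfl

theorem hasDerivAt_cayleyPow_zero {d : ℕ} (hd : 2 ≤ d) (a : ℂˣ) :
    HasDerivAt (fun w : ℂ => (w ^ d - a) / (w ^ d + a)) 0 0 := by
  refine (hasDerivAt_cayleyPow (a := a) (z := 0) ?_).congr_deriv ?_
  · simp [show d ≠ 0 by omega]
  · simp [show d - 1 ≠ 0 by omega]

theorem deck_cayleyPow_sq {d : ℕ} (hd : Even d) (hd0 : d ≠ 0) (a : ℂˣ) :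
    Nonempty (Deck (cayleyPow d a)^[2] ≃* DihedralGroup d) := by
  have hd2 : 2 ≤ d := by obtain ⟨k, rfl⟩ := hd; omega
  have hF : (cayleyPow d a)^[2] = fun x => cayleyPow d a (cayleyPow d a x) := rfl
  obtain ⟨e, he⟩ := exists_unit_pow_eq hd0 (a ^ 2)
  rw [hF]
  refine nonempty_mulEquiv_dihedralGroup hd0 _ e ?_ (fun u => ⟨fun h => ?_, fun h => ?_⟩) ?_
  · refine mem_Deck_cayleyPow_comp.2 fun x => ?_
    rw [cayleyPow_inversion hd0 he, spherePow_scaling_neg_one hd]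
  -- Testing at a zero `z` of the inner map shows that `u * z` is also a `d`-th root of `a`.
  · obtain ⟨z, hz⟩ := exists_unit_pow_eq hd0 a
    have hz' : (z : ℂ) ^ d = a := by rw [← hz]; simp
    have h1 := mem_Deck_cayleyPow_comp.1 h (z : ℂ)
    rw [cayleyPow_eq_zero_iff.2 ⟨z, rfl, hz'⟩, spherePow_coe, zero_pow hd0,
      spherePow_eq_coe_iff] at h1
    obtain ⟨w, hw, hw0⟩ := h1
    rw [pow_eq_zero_iff hd0] at hw0
    rw [hw0, scaling_coe, cayleyPow_eq_zero_iff] at hw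
    obtain ⟨y, hy, hya⟩ := hw
    rw [OnePoint.coe_eq_coe] at hy
    rw [← hy, mul_pow, hz'] at hya
    exact Units.ext (by simpa using hya)
  · refine mem_Deck_cayleyPow_comp.2 fun x => ?_
    rw [cayleyPow_scaling_of_pow_eq_one h]
  · intro μ hμ
    refine apply_zero_mem_of_spherePow_comp_eq hd0 (hasDerivAt_cayleyPow_zero hd2 a)
      (eventually_cayleyPow_coe (by simp [hd0])) (fun w hw hfib => ?_) μ
      (mem_Deck_cayleyPow_comp.1 hμ)
    have hwa : w ^ d + a ≠ 0 := by
      intro h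
      rw [cayleyPow_eq_infty_iff.2 ⟨w, rfl, h⟩, cayleyPow_zero hd0] at hfib
      simp at hfib
    exact ⟨⟨_, deriv_cayleyPow_ne_zero hd0 hwa hw, hasDerivAt_cayleyPow hwa⟩,
      eventually_cayleyPow_coe hwa⟩

/-! ### The third iterate. -/

theorem cayleyPow_cayleyPow_eq_infty_iff {d : ℕ} {z : ℂ} :
    cayleyPow d 1 (cayleyPow d 1 z) = ∞ ↔
      z ^ d + 1 ≠ 0 ∧ ((z ^ d - 1) / (z ^ d + 1)) ^ d = -1 := by
  rw [cayleyPow_eq_infty_iff]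
  by_cases h : z ^ d + 1 = 0
  · have hz : cayleyPow d 1 z = ∞ := cayleyPow_eq_infty_iff.2 ⟨z, rfl, by simpa using h⟩
    simp [hz, h]
  · rw [cayleyPow_coe (by simpa using h)]
    simp [h, add_eq_zero_iff_eq_neg]

theorem Complex.re_eq_zero_of_norm_sub_one_eq {w : ℂ} (h : ‖w - 1‖ = ‖w + 1‖) : w.re = 0 := by
  have h2 : ‖w - 1‖ ^ 2 = ‖w + 1‖ ^ 2 := by rw [h]
  rw [← Complex.normSq_eq_norm_sq, ← Complex.normSq_eq_norm_sq, Complex.normSq_apply,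
    Complex.normSq_apply] at h2
  simp at h2
  linarith

/-- The poles of the second iterate form a finite nonempty set stable under `u`, so `‖u‖ = 1`. Their
`d`-th powers are nonzero and purely imaginary, so `u ^ d` is real, hence `±1`. -/
theorem pow_sq_eq_one_of_scaling_mem {d : ℕ} (hd : Even d) (hd0 : d ≠ 0) {u : ℂˣ}
    (h : ∀ x, spherePow d (cayleyPow d 1 (cayleyPow d 1
      ((scaling u : Equiv.Perm (OnePoint ℂ)) x))) =
        spherePow d (cayleyPow d 1 (cayleyPow d 1 x))) : u ^ (2 * d) = 1 := by
  set T : Set ℂ := {z | z ^ d + 1 ≠ 0 ∧ ((z ^ d - 1) / (z ^ d + 1)) ^ d = -1} with hT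
  have hmul : ∀ z ∈ T, u * z ∈ T := by
    intro z hz
    have h1 := h (z : OnePoint ℂ)
    rw [cayleyPow_cayleyPow_eq_infty_iff.2 hz, spherePow_infty, scaling_coe] at h1
    refine cayleyPow_cayleyPow_eq_infty_iff.1 ?_
    generalize cayleyPow d 1 _ = y at h1 ⊢
    cases y using OnePoint.rec with
    | infty => rfl
    | coe y => simp at h1
  have hfin : T.Finite := by
    set P : Polynomial ℂ := (Polynomial.X ^ d - 1) ^ d + (Polynomial.X ^ d + 1) ^ d with hP
    have hP0 : P ≠ 0 := by
      intro h0
      have := congrArg (Polynomial.eval 0) h0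
      simp [hP, hd0, hd.neg_one_pow] at this
    refine (P.rootSet_finite ℂ).subset fun z hz => ?_
    rw [Polynomial.mem_rootSet]
    refine ⟨hP0, ?_⟩
    have h2 := hz.2
    rw [div_pow, div_eq_iff (pow_ne_zero _ hz.1)] at h2
    simp [hP, h2]
  have himag : ∀ z ∈ T, (z ^ d).re = 0 ∧ (z ^ d).im ≠ 0 := by
    intro z hz
    have hre : (z ^ d).re = 0 := by
      apply Complex.re_eq_zero_of_norm_sub_one_eq
      have h2 := congrArg norm hz.2
      rw [norm_pow, norm_neg, norm_one, pow_eq_one_iff_of_nonneg (norm_nonneg _) hd0, norm_div,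
        div_eq_one_iff_eq (norm_ne_zero_iff.2 hz.1)] at h2
      exact h2
    refine ⟨hre, fun him => ?_⟩
    have h0 : z ^ d = 0 := Complex.ext hre him
    have h2 := hz.2
    rw [h0] at h2
    norm_num [hd.neg_one_pow] at h2
  obtain ⟨z, hz⟩ : T.Nonempty := by
    -- A pole comes from solving `(z ^ d - 1) / (z ^ d + 1) = ζ` with `ζ ^ d = -1`.
    obtain ⟨ζ, hζ⟩ := exists_unit_pow_eq hd0 (-1)
    have hζ' : (ζ : ℂ) ^ d = -1 := by rw [← Units.val_pow_eq_pow_val, hζ]; simp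
    have h1 : 1 - (ζ : ℂ) ≠ 0 := by
      intro h1
      rw [← sub_eq_zero.1 h1] at hζ'
      norm_num at hζ'
    obtain ⟨z, hz⟩ := IsAlgClosed.exists_pow_nat_eq ((1 + (ζ : ℂ)) / (1 - ζ))
      (Nat.pos_of_ne_zero hd0)
    have h2 : z ^ d + 1 = 2 / (1 - ζ) := by rw [hz]; field_simp; ring
    have h3 : z ^ d - 1 = 2 * ζ / (1 - ζ) := by rw [hz]; field_simp; ring
    refine ⟨z, ?_, ?_⟩
    · rw [h2]
      exact div_ne_zero two_ne_zero h1
    · rw [h2, h3, div_div_div_cancel_right₀ h1, mul_div_cancel_left₀ _ two_ne_zero, hζ']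
  have hz0 : z ≠ 0 := by
    rintro rfl
    exact (himag 0 hz).2 (by simp [hd0])
  have hiter : ∀ n : ℕ, (u : ℂ) ^ n * z ∈ T := by
    intro n
    induction n with
    | zero => simpa using hz
    | succ n ih => rw [pow_succ', mul_assoc]; exact hmul _ ih
  have hnorm : ‖(u : ℂ)‖ = 1 := by
    have := hfin.to_subtype
    obtain ⟨i, j, hij, heq⟩ := Finite.exists_ne_map_eq_of_infinite
      (fun n : ℕ => (⟨_, hiter n⟩ : T))
    have heq' : (u : ℂ) ^ i = (u : ℂ) ^ j := mul_right_cancel₀ hz0 (congrArg Subtype.val heq)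
    by_contra hne
    have := congrArg norm heq'
    rw [norm_pow, norm_pow] at this
    exact hij (pow_right_injective₀ (norm_pos_iff.2 u.ne_zero) hne this)
  have hnormd : ‖(u : ℂ) ^ d‖ ^ 2 = 1 := by rw [norm_pow, hnorm]; simp
  have him : ((u : ℂ) ^ d).im = 0 := by
    have h1 := (himag _ (hmul z hz)).1
    rw [mul_pow, Complex.mul_re, (himag z hz).1, mul_zero, zero_sub, neg_eq_zero] at h1
    exact (mul_eq_zero.1 h1).resolve_right (himag z hz).2
  have hsq : ((u : ℂ) ^ d) ^ 2 = 1 := by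
    rw [← Complex.normSq_eq_norm_sq, Complex.normSq_apply, him] at hnormd
    apply Complex.ext
    · rw [pow_two, Complex.mul_re, him, Complex.one_re]
      linarith
    · rw [pow_two, Complex.mul_im, him]
      simp
  refine Units.ext ?_
  rw [Units.val_pow_eq_pow_val, mul_comm, pow_mul, hsq, Units.val_one]

theorem deck_cayleyPow_cube {d : ℕ} (hd : Even d) (hd0 : d ≠ 0) :
    Nonempty (Deck (cayleyPow d 1)^[3] ≃* DihedralGroup (2 * d)) := by
  have hd2 : 2 ≤ d := by obtain ⟨k, rfl⟩ := hd; omega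
  have hF : (cayleyPow d 1)^[3] =
      fun x => cayleyPow d 1 ((fun y => cayleyPow d 1 (cayleyPow d 1 y)) x) := rfl
  have hinv : ∀ x, cayleyPow d 1 (cayleyPow d 1 ((inversion 1 : Equiv.Perm (OnePoint ℂ)) x)) =
      cayleyPow d 1 (cayleyPow d 1 x) := fun x => by
    rw [cayleyPow_inversion hd0 (by simp), cayleyPow_scaling_of_pow_eq_one hd.neg_one_pow]
  rw [hF]
  refine nonempty_mulEquiv_dihedralGroup (mul_ne_zero two_ne_zero hd0) _ 1 ?_
    (fun u => ⟨fun h => ?_, fun h => ?_⟩) ?_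
  · refine mem_Deck_cayleyPow_comp.2 fun x => ?_
    rw [hinv]
  · exact pow_sq_eq_one_of_scaling_mem hd hd0 (mem_Deck_cayleyPow_comp.1 h)
  · refine mem_Deck_cayleyPow_comp.2 fun x => ?_
    rw [mul_comm, pow_mul] at h
    have h' : u ^ d = 1 ∨ u ^ d = -1 := by
      have := congrArg Units.val h
      rw [Units.val_pow_eq_pow_val, Units.val_one, sq_eq_one_iff] at this
      simpa [Units.ext_iff] using this
    rcases h' with h' | h'
    · rw [cayleyPow_scaling_of_pow_eq_one h']
    -- The rotation becomes `1 / z` after one step and `-z` after two.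
    · rw [cayleyPow_scaling_of_pow_eq_neg_one h', cayleyPow_inversion hd0 (by simp),
        spherePow_scaling_neg_one hd]
  · intro μ hμ
    set k : ℂ → ℂ := fun w => (w ^ d - (1 : ℂˣ)) / (w ^ d + (1 : ℂˣ)) with hk
    have hk0 : k 0 = -1 := by simp [hk, hd0]
    have hlocal : ∀ z : ℂ, z ^ d + (1 : ℂˣ) ≠ 0 → k z ^ d + (1 : ℂˣ) ≠ 0 →
        ∀ᶠ w : ℂ in 𝓝 z, cayleyPow d 1 (cayleyPow d 1 w) = (k (k w) : OnePoint ℂ) := by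
      intro z h1 h2
      filter_upwards [eventually_cayleyPow_coe h1,
        (hasDerivAt_cayleyPow h1).continuousAt.eventually (eventually_cayleyPow_coe h2)]
        with w h3 h4
      rw [h3, h4]
    have h1 : k 0 ^ d + (1 : ℂˣ) ≠ 0 := by
      rw [hk0, hd.neg_one_pow]
      norm_num
    have h00 : cayleyPow d 1 (cayleyPow d 1 ((0 : ℂ) : OnePoint ℂ)) = ((0 : ℂ) : OnePoint ℂ) := by
      rw [cayleyPow_zero hd0]
      exact cayleyPow_eq_zero_iff.2 ⟨-1, rfl, by simp [hd.neg_one_pow]⟩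
    refine apply_zero_mem_of_spherePow_comp_eq hd0 (k := fun z => k (k z)) ?_
      (hlocal 0 (by simp [hd0]) h1) (fun w hw hfib => ?_) μ (mem_Deck_cayleyPow_comp.1 hμ)
    · refine (HasDerivAt.comp 0 (hasDerivAt_cayleyPow h1)
        (hasDerivAt_cayleyPow_zero hd2 1)).congr_deriv (mul_zero _)
    · simp only [h00, spherePow_coe, zero_pow hd0] at hfib
      -- As `0 ↦ -1 ↦ 0`, the fibre consists of zeros of the second iterate. So `k w ^ d = 1`:
      -- neither `w` nor `k w` is a pole, `k w ≠ 0`, and the chain rule gives a nonzero derivative.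
      obtain ⟨y, hy, hy0⟩ := spherePow_eq_coe_iff.1 hfib
      rw [pow_eq_zero_iff hd0] at hy0
      rw [hy0] at hy
      obtain ⟨v, hv, hv1⟩ := cayleyPow_eq_zero_iff.1 hy
      have hw1 : w ^ d + (1 : ℂˣ) ≠ 0 := by
        intro h
        rw [cayleyPow_eq_infty_iff.2 ⟨w, rfl, h⟩] at hv
        exact OnePoint.infty_ne_coe v hv
      rw [cayleyPow_coe hw1, OnePoint.coe_eq_coe] at hv
      have hkv : k w = v := hv
      have hkd : k w ^ d + (1 : ℂˣ) ≠ 0 := by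
        rw [hkv, hv1]
        norm_num
      have hkw0 : k w ≠ 0 := by
        intro h
        rw [← hkv, h, zero_pow hd0] at hv1
        simp at hv1
      exact ⟨⟨_, mul_ne_zero (deriv_cayleyPow_ne_zero hd0 hkd hkw0)
        (deriv_cayleyPow_ne_zero hd0 hw1 hw),
        HasDerivAt.comp w (hasDerivAt_cayleyPow hkd) (hasDerivAt_cayleyPow hw1)⟩,
        hlocal w hw1 hkd⟩

end

theorem propositionp (d : ℕ) (hd : Even d) (hd0 : 0 < d) :
    (∀ a : ℂ, a ≠ 0 →
      Nonempty
        (Deck ((RatFunc.sphereMap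
          ((RatFunc.X ^ d - RatFunc.C a) / (RatFunc.X ^ d + RatFunc.C a)))^[2]) ≃*
          DihedralGroup d)) ∧
    Nonempty
      (Deck ((RatFunc.sphereMap ((RatFunc.X ^ d - 1) / (RatFunc.X ^ d + 1)))^[3]) ≃*
        DihedralGroup (2 * d)) := by
  refine ⟨fun a ha => ?_, ?_⟩
  · have h := sphereMap_eq_cayleyPow hd0.ne' (Units.mk0 a ha)
    rw [Units.val_mk0] at h
    rw [h]
    exact deck_cayleyPow_sq hd hd0.ne' _
  · have h := sphereMap_eq_cayleyPow hd0.ne' 1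
    rw [Units.val_one, map_one] at h
    rw [h]
    exact deck_cayleyPow_cube hd hd0.ne'
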